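/- A clustering game $\Gamma=(G,c,(S_i),\alpha,w,q)$ consists of a finite undirected graph $G=(V,E)$ whose nodes are the players and whose edge set is partitioned into coordination edges $E_c$ and anti-coordination edges $E_a$, a number $c$ of colors, a set $S_i\subseteq[c]$ of available colors for every player $i$, split parameters $\alpha_{ij}\ge 0$ with $\alpha_{ij}+\alpha_{ji}>0$ for every edge $\{i,j\}$, edge weights $w_e\ge 0$, and individual preferences $q_i:S_i\to\mathbb{R}_{\ge 0}$. In a profile $s\in\prod_i S_i$ player $i$ has utility $$u_i(s)=q_i(s_i)+\sum_{\{i,j\}\in E_c:\,s_i=s_j}\frac{\alpha_{ij}}{\alpha_{ij}+\alpha_{ji}}w_{ij}+\sum_{\{i,j\}\in E_a:\,s_i\ne s_j}\frac{\alpha_{ij}}{\alpha_{ij}+\alpha_{ji}}w_{ij},$$ the social welfare is $u(s)=\sum_i u_i(s)$, and $\mathrm{PoA}(\Gamma)=\max_s u(s^*)/u(s)$, where $s$ runs over the pure Nash equilibria of $\Gamma$ and $s^*$ maximizes $u$. The Price of Anarchy of a class $\mathcal G$ of games is $\mathrm{PoA}(\mathcal{G})=\sup_{\Gamma\in\mathcal{G}}\mathrm{PoA}(\Gamma)$,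 where games in which all profiles have welfare $0$ are disregarded. **Theorem (Dense random coordination games).** For a graph $G$ and $c\in\mathbb{N}$ let $\mathcal{G}_G(c)$ be the class of all symmetric ($S_i=[c]$ for all $i$) coordination games ($E_a=\emptyset$) on $G$ with $c$ colors, equal-split distribution rule ($\alpha_{ij}=\alpha_{ji}$), arbitrary weights $w\ge 0$ and no individual preferences ($q=0$). For every constant $0<d\le 1$ there is a constant $\beta=\beta(d)>0$ such that, for every sequence $(c_n)_{n\in\mathbb{N}}$ of numbers of colors with $c_n\to\infty$, and for the random graph $G_n\sim G(n,d)$, $$\lim_{n\to\infty}\mathbb{P}\bigl\{\mathrm{PoA}(\mathcal{G}_{G_n}(c_n))\ge\beta\cdot\min\{c_n,n\}\bigr\}=1 .$$ In particular $\mathrm{PoA}(\mathcal{G}_{G_n}(c_n))\ge\beta c_n$ with high probability whenever $c_n\le n$ for all large $n$. -/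

import Mathlib

open Filter Topology
open scoped ENNReal SimpleGraph

/-- A clustering game on the graph `G` (whose nodes are the players) with the colors
`Fin c`. -/
structure ClusteringGame {V : Type*} (G : SimpleGraph V) (c : ℕ) where
  /-- the coordination edges `E_c` -/
  coordEdges : Set (Sym2 V)
  /-- the anti-coordination edges `E_a` -/
  antiEdges : Set (Sym2 V)
  edges_eq : coordEdges ∪ antiEdges = G.edgeSet
  edges_disjoint : Disjoint coordEdges antiEdges
  /-- the set `S_i` of colors available to player `i` -/
  colors : V → Set (Fin c)
  /-- the distribution rule: `split i j` is the split parameter `α_{ij}`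
  of player `i` on the edge `{i, j}` (only its values on edges matter) -/
  split : V → V → ℝ
  split_nonneg : ∀ i j, G.Adj i j → 0 ≤ split i j
  split_pos : ∀ i j, G.Adj i j → 0 < split i j + split j i
  /-- the edge weights (only their values on edges matter) -/
  weight : Sym2 V → ℝ
  weight_nonneg : ∀ e ∈ G.edgeSet, 0 ≤ weight e
  /-- the individual preferences: `pref i a` is `q_i(a)` (only its values at `a ∈ S_i` matter) -/
  pref : V → Fin c → ℝ
  pref_nonneg : ∀ i, ∀ a ∈ colors i, 0 ≤ pref i a

namespace ClusteringGame

variable {V : Type*} {G : SimpleGraph V} {c : ℕ}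

/-- The strategy profiles of the game: every player chooses one of her available colors. -/
def IsProfile (Γ : ClusteringGame G c) (s : V → Fin c) : Prop :=
  ∀ i, s i ∈ Γ.colors i

/-- The part of the weight of the edge `{i, j}` that player `i` gets if the edge is satisfied. -/
noncomputable def share (Γ : ClusteringGame G c) (i j : V) : ℝ :=
  Γ.split i j / (Γ.split i j + Γ.split j i) * Γ.weight s(i, j)

open Classical in
/-- The utility `u_i(s)` of player `i`. -/
noncomputable def utility [Fintype V] (Γ : ClusteringGame G c) (s : V → Fin c) (i : V) : ℝ :=
  Γ.pref i (s i)
    + (∑ j : V, if s(i, j) ∈ Γ.coordEdges ∧ s i = s j then Γ.share i j else 0)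
    + (∑ j : V, if s(i, j) ∈ Γ.antiEdges ∧ s i ≠ s j then Γ.share i j else 0)

/-- The social welfare `u(s)`. -/
noncomputable def welfare [Fintype V] (Γ : ClusteringGame G c) (s : V → Fin c) : ℝ :=
  ∑ i : V, Γ.utility s i

/-- `s` is an `ε`-approximate `k`-strong equilibrium: for every joint deviation of a (nonempty)
set `K` of at most `k` players to a profile `s'`, some member of `K` does not improve her
utility by more than a factor `ε`. -/
def IsApproxStrongEq [Fintype V] (Γ : ClusteringGame G c) (ε : ℝ) (k : ℕ) (s : V → Fin c) :
    Prop :=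
  Γ.IsProfile s ∧ ∀ K : Finset V, K.Nonempty → K.card ≤ k → ∀ s' : V → Fin c,
    Γ.IsProfile s' → (∀ i, i ∉ K → s' i = s i) → ∃ j ∈ K, Γ.utility s' j ≤ ε * Γ.utility s j

/-- A pure Nash equilibrium. -/
def IsNash [Fintype V] (Γ : ClusteringGame G c) (s : V → Fin c) : Prop :=
  Γ.IsApproxStrongEq 1 1 s

/-- The social welfare of a social optimum. -/
noncomputable def optWelfare [Fintype V] (Γ : ClusteringGame G c) : ℝ≥0∞ :=
  ⨆ t : {t : V → Fin c // Γ.IsProfile t}, ENNReal.ofReal (Γ.welfare t)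

/-- The Price of Anarchy of a game: the worst ratio `u(s*) / u(s)` over the pure Nash equilibria
`s`, with `x / 0 = ∞` for `x > 0`; a degenerate game in which every profile has welfare
`0` gets the value `0` and so never contributes to the supremum over a class. -/
noncomputable def poa [Fintype V] (Γ : ClusteringGame G c) : ℝ≥0∞ :=
  ⨆ s : {s : V → Fin c // Γ.IsNash s}, Γ.optWelfare / ENNReal.ofReal (Γ.welfare s)

/-- Symmetric: every player has all colors available. -/
def IsSymmetric (Γ : ClusteringGame G c) : Prop :=
  ∀ i, Γ.colors i = Set.univ

/-- Coordination game: there are no anti-coordination edges. -/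
def IsCoordination (Γ : ClusteringGame G c) : Prop :=
  Γ.antiEdges = ∅

/-- Equal-split distribution rule. -/
def IsEqualSplit (Γ : ClusteringGame G c) : Prop :=
  ∀ i j, G.Adj i j → Γ.split i j = Γ.split j i

/-- No individual preferences. -/
def HasNoPreferences (Γ : ClusteringGame G c) : Prop :=
  ∀ i a, Γ.pref i a = 0

/-- The Price of Anarchy of a class of games on the graph `G` with `c` colors. -/
noncomputable def poaClass [Fintype V] (𝒢 : Set (ClusteringGame G c)) : ℝ≥0∞ :=
  ⨆ Γ ∈ 𝒢, Γ.poa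

end ClusteringGame

/-- The class of all symmetric coordination games on the graph `G` with `c` colors, with
equal-split distribution rule, arbitrary nonnegative edge weights and without individual
preferences. -/
def symmetricCoordinationGames {V : Type*} (G : SimpleGraph V) (c : ℕ) :
    Set (ClusteringGame G c) :=
  {Γ | Γ.IsSymmetric ∧ Γ.IsCoordination ∧ Γ.IsEqualSplit ∧ Γ.HasNoPreferences}

/-! Fix disjoint pairs of vertices in advance. Put weight 1 on the pair edges present in G and on
the edges of G joining first vertices of two pairs whose own edges are present; all other weights
are 0. If the pairs get distinct colors, a vertex sees each color at most once among its weighted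
neighbors, and a non-isolated one sees its own color on its partner. So this is an equilibrium, of
welfare at most the number of pairs, while a constant coloring earns every weighted edge
(`ofReal_le_poaClass_of_pairs`). With 2M pairs in two halves, about d³M² cross combinations have all
three edges, by Chebyshev (`measure_card_filter_lt_le`), so the ratio is of order d³M. This needs 4M
vertices and 2M colors, hence M of order min(c, n). -/

/-! ### Games with 0/1 weights -/

open Classical in
/-- The equal-split symmetric coordination game on `G` in which the edges of `H` have weight `1`
and all other edges have weight `0`. -/
noncomputable def ClusteringGame.ofWeightGraph {V : Type*} (G H : SimpleGraph V) (c : ℕ) :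
    ClusteringGame G c where
  coordEdges := G.edgeSet
  antiEdges := ∅
  edges_eq := by simp
  edges_disjoint := by simp
  colors _ := Set.univ
  split _ _ := 1
  split_nonneg _ _ _ := zero_le_one
  split_pos _ _ _ := by norm_num
  weight e := if e ∈ H.edgeSet then 1 else 0
  weight_nonneg e _ := by split_ifs <;> norm_num
  pref _ _ := 0
  pref_nonneg _ _ _ := le_rfl

namespace ClusteringGame

variable {V : Type*} {G H : SimpleGraph V} {c : ℕ}

lemma ofWeightGraph_mem : ofWeightGraph G H c ∈ symmetricCoordinationGames G c :=
  ⟨fun _ => rfl, rfl, fun _ _ _ => rfl, fun _ _ => rfl⟩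

variable [Fintype V]

open Classical in
lemma utility_ofWeightGraph (hHG : H ≤ G) (s : V → Fin c) (i : V) :
    (ofWeightGraph G H c).utility s i
      = (Finset.univ.filter fun j => H.Adj i j ∧ s j = s i).card / 2 := by
  have h : ∀ j, (if s(i, j) ∈ (ofWeightGraph G H c).coordEdges ∧ s i = s j then
      (ofWeightGraph G H c).share i j else 0)
      = if H.Adj i j ∧ s j = s i then (1 / 2 : ℝ) else 0 := by
    intro j
    by_cases hH : H.Adj i j
    · have hG := hHG hH
      by_cases hs : s i = s j
      · norm_num [ofWeightGraph, share, hH, hG, hs]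
      · simp [hs, Ne.symm hs]
    · simp [ofWeightGraph, share, hH]
  rw [utility, Finset.sum_congr rfl fun j _ => h j, ← Finset.sum_filter]
  simp [ofWeightGraph, div_eq_mul_inv]

open Classical in
lemma isNash_ofWeightGraph (hHG : H ≤ G) (s : V → Fin c)
    (hs : ∀ i a, (Finset.univ.filter fun j => H.Adj i j ∧ s j = a).card
      ≤ (Finset.univ.filter fun j => H.Adj i j ∧ s j = s i).card) :
    (ofWeightGraph G H c).IsNash s := by
  refine ⟨fun i => Set.mem_univ _, fun K hK hcard s' _ hs' => ?_⟩
  obtain ⟨i, rfl⟩ := Finset.card_eq_one.1 (le_antisymm hcard hK.card_pos)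
  refine ⟨i, Finset.mem_singleton_self i, ?_⟩
  rw [utility_ofWeightGraph hHG, utility_ofWeightGraph hHG, one_mul]
  have h : (Finset.univ.filter fun j => H.Adj i j ∧ s' j = s' i)
      = Finset.univ.filter fun j => H.Adj i j ∧ s j = s' i := by
    refine Finset.filter_congr fun j _ => and_congr_right fun hij => ?_
    rw [hs' j (by simpa using hij.ne')]
  rw [h]
  exact div_le_div_of_nonneg_right (by exact_mod_cast hs i (s' i)) two_pos.le

/-- The product form of `h` also covers an equilibrium of welfare 0, where `hpos` makes the quotient
infinite rather than 0/0. -/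
lemma ofReal_le_poaClass {𝒢 : Set (ClusteringGame G c)} {Γ : ClusteringGame G c} (hΓ : Γ ∈ 𝒢)
    {s t : V → Fin c} (hs : Γ.IsNash s) (ht : Γ.IsProfile t) (hpos : 0 < Γ.welfare t)
    {r : ℝ} (hr : 0 ≤ r) (h : r * Γ.welfare s ≤ Γ.welfare t) :
    ENNReal.ofReal r ≤ poaClass 𝒢 := by
  have hopt : ENNReal.ofReal (Γ.welfare t) ≤ Γ.optWelfare :=
    le_iSup (fun t : {t : V → Fin c // Γ.IsProfile t} => ENNReal.ofReal (Γ.welfare t)) ⟨t, ht⟩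
  have hpoa : Γ.optWelfare / ENNReal.ofReal (Γ.welfare s) ≤ Γ.poa :=
    le_iSup (fun s : {s : V → Fin c // Γ.IsNash s} =>
      Γ.optWelfare / ENNReal.ofReal (Γ.welfare s)) ⟨s, hs⟩
  refine le_trans (le_trans ?_ hpoa) (le_iSup₂_of_le Γ hΓ le_rfl)
  rw [ENNReal.le_div_iff_mul_le (Or.inr ((ENNReal.ofReal_pos.2 hpos).trans_le hopt).ne')
    (Or.inl ENNReal.ofReal_ne_top), ← ENNReal.ofReal_mul hr]
  exact (ENNReal.ofReal_le_ofReal h).trans hopt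

end ClusteringGame

/-! ### The bad equilibrium on a pair graph -/

/-- The spanning subgraph of `G` with the edges of the pairs `f (i, false)`, `f (i, true)`, and
the edges of `G` between the first vertices of any two of these pairs that are edges of `G`. -/
def SimpleGraph.pairGraph {V ι : Type*} (G : SimpleGraph V) (f : ι × Bool ↪ V) :
    SimpleGraph V where
  Adj u v := G.Adj u v ∧ ∃ p q : ι × Bool, f p = u ∧ f q = v ∧
    (p.1 = q.1 ∨ p.2 = false ∧ q.2 = false ∧
      G.Adj (f (p.1, false)) (f (p.1, true)) ∧ G.Adj (f (q.1, false)) (f (q.1, true)))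
  symm := ⟨by
    rintro u v ⟨h, p, q, hp, hq, hpq⟩
    exact ⟨h.symm, q, p, hq, hp, by tauto⟩⟩
  loopless := ⟨fun u h => G.loopless.irrefl u h.1⟩

namespace SimpleGraph

variable {V ι : Type*} {G : SimpleGraph V} {f : ι × Bool ↪ V}

lemma pairGraph_le : G.pairGraph f ≤ G := fun _ _ h => h.1

/-- The color of the pair on its two vertices, and a default color on all other vertices. -/
noncomputable def pairColoring {c : ℕ} (f : ι × Bool ↪ V) (col : ι → Fin c) (a : Fin c) :
    V → Fin c :=
  Function.extend f (fun p => col p.1) fun _ => a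

lemma pairColoring_apply {c : ℕ} (col : ι → Fin c) (a : Fin c) (p : ι × Bool) :
    pairColoring f col a (f p) = col p.1 :=
  f.injective.extend_apply _ _ p

open Classical in
-- A color determines its pair. Inside that pair a vertex can only see its partner, and from another
-- pair it can only see the first vertex.
lemma card_pairGraph_color_le_one [Fintype V] {c : ℕ} {col : ι → Fin c}
    (hcol : Function.Injective col) (a b : Fin c) (v : V) :
    (Finset.univ.filter fun w => (G.pairGraph f).Adj v w ∧ pairColoring f col a w = b).card
      ≤ 1 := by
  rw [Finset.card_le_one]
  intro w hw w' hw'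
  simp only [Finset.mem_filter, Finset.mem_univ, true_and] at hw hw'
  obtain ⟨⟨h, p, q, rfl, rfl, hpq⟩, hb⟩ := hw
  obtain ⟨⟨h', p', q', hp', rfl, hpq'⟩, hb'⟩ := hw'
  obtain rfl := f.injective hp'
  rw [pairColoring_apply] at hb hb'
  have hq : q.1 = q'.1 := hcol (hb.trans hb'.symm)
  have hne : p' ≠ q := fun e => h.ne (congrArg f e)
  have hne' : p' ≠ q' := fun e => h'.ne (congrArg f e)
  congr 1
  obtain ⟨i, x⟩ := p'
  obtain ⟨j, y⟩ := q
  obtain ⟨k, z⟩ := q'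
  cases x <;> cases y <;> cases z <;> grind

open Classical in
-- The equilibrium condition: no color occurs twice around `v`, and any neighbor at all forces the
-- partner, which shares the color of `v`, to be adjacent. For cross edges this is why both pair
-- edges are required in `pairGraph`.
lemma card_pairGraph_color_le [Fintype V] {c : ℕ} {col : ι → Fin c}
    (hcol : Function.Injective col) (a b : Fin c) (v : V) :
    (Finset.univ.filter fun w => (G.pairGraph f).Adj v w ∧ pairColoring f col a w = b).card
      ≤ (Finset.univ.filter fun w => (G.pairGraph f).Adj v w ∧
          pairColoring f col a w = pairColoring f col a v).card := by
  rcases Finset.eq_empty_or_nonempty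
    (Finset.univ.filter fun w => (G.pairGraph f).Adj v w ∧ pairColoring f col a w = b)
    with h0 | ⟨w, hw⟩
  · simp [h0]
  refine (card_pairGraph_color_le_one hcol a b v).trans (Finset.card_pos.2 ?_)
  simp only [Finset.mem_filter, Finset.mem_univ, true_and] at hw
  obtain ⟨⟨h, p, q, rfl, rfl, hpq⟩, -⟩ := hw
  rcases hpq with hpq | ⟨hp, hq, hp', -⟩
  · exact ⟨f q, by simpa [pairColoring_apply, hpq] using ⟨h, p, q, rfl, rfl, Or.inl hpq⟩⟩
  · obtain ⟨i, x⟩ := p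
    obtain rfl : x = false := hp
    refine ⟨f (i, true), ?_⟩
    simpa [pairColoring_apply] using ⟨hp', (i, false), (i, true), rfl, rfl, Or.inl rfl⟩

end SimpleGraph

open ClusteringGame SimpleGraph in
open Classical in
lemma ofReal_le_poaClass_of_pairs {V ι : Type*} [Fintype V] [Fintype ι] (G : SimpleGraph V)
    (f : ι × Bool ↪ V) {c : ℕ} (col : ι ↪ Fin c) (P : Finset (ι × ι)) (hP : P.Nonempty)
    (hne : ∀ p ∈ P, ∀ q ∈ P, p.1 ≠ q.2)
    (hadj : ∀ p ∈ P, G.Adj (f (p.1, false)) (f (p.1, true)) ∧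
      G.Adj (f (p.2, false)) (f (p.2, true)) ∧ G.Adj (f (p.1, false)) (f (p.2, false)))
    {r : ℝ} (hr : 0 ≤ r) (h : r * Fintype.card ι ≤ P.card) :
    ENNReal.ofReal r ≤ poaClass (symmetricCoordinationGames G c) := by
  set H := G.pairGraph f with hH
  have hHG : H ≤ G := pairGraph_le
  obtain ⟨p₀, hp₀⟩ := hP
  -- Any color would do as default, since vertices outside the pairs are isolated in `H`; `hP`
  -- guarantees that one exists.
  set a : Fin c := col p₀.1
  set s := pairColoring f col a with hs
  have hopt : (P.card : ℝ) ≤ (ofWeightGraph G H c).welfare fun _ => a := by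
    -- Each edge from `P` is counted in both orientations; `hne` keeps the two families apart.
    have key : P.card + P.card
        ≤ ∑ v : V, (Finset.univ.filter fun w => H.Adj v w).card := by
      rw [← Finset.card_sigma]
      have hadj' : ∀ p ∈ P, H.Adj (f (p.1, false)) (f (p.2, false)) := fun p hp =>
        ⟨(hadj p hp).2.2, _, _, rfl, rfl, Or.inr ⟨rfl, rfl, (hadj p hp).1, (hadj p hp).2.1⟩⟩
      have hdisj : Disjoint
          (P.image fun p => (⟨f (p.1, false), f (p.2, false)⟩ : Σ _ : V, V))
          (P.image fun p => (⟨f (p.2, false), f (p.1, false)⟩ : Σ _ : V, V)) := by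
        rw [Finset.disjoint_left]
        intro e he he'
        simp only [Finset.mem_image] at he he'
        obtain ⟨p, hp, rfl⟩ := he
        obtain ⟨q, hq, hqp⟩ := he'
        simp only [Sigma.mk.injEq, heq_eq_eq, EmbeddingLike.apply_eq_iff_eq,
          Prod.mk.injEq, and_true] at hqp
        exact hne p hp q hq hqp.1.symm
      calc P.card + P.card
          = ((P.image fun p => (⟨f (p.1, false), f (p.2, false)⟩ : Σ _ : V, V)) ∪
            (P.image fun p => (⟨f (p.2, false), f (p.1, false)⟩ : Σ _ : V, V))).card := by
            rw [Finset.card_union_of_disjoint hdisj, Finset.card_image_of_injective,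
              Finset.card_image_of_injective]
            · rintro ⟨i, j⟩ ⟨i', j'⟩ h
              simp only [Sigma.mk.injEq, heq_eq_eq, EmbeddingLike.apply_eq_iff_eq,
                Prod.mk.injEq, and_true] at h
              simp [h]
            · rintro ⟨i, j⟩ ⟨i', j'⟩ h
              simp only [Sigma.mk.injEq, heq_eq_eq, EmbeddingLike.apply_eq_iff_eq,
                Prod.mk.injEq, and_true] at h
              simp [h]
        _ ≤ _ := by
            refine Finset.card_le_card (Finset.union_subset ?_ ?_) <;>
              · intro e he
                obtain ⟨p, hp, rfl⟩ := Finset.mem_image.1 he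
                simp [hadj' p hp, (hadj' p hp).symm]
    simp only [welfare, utility_ofWeightGraph hHG, and_true, ← Finset.sum_div]
    rw [le_div_iff₀ two_pos, mul_two]
    exact_mod_cast key
  have heq : (ofWeightGraph G H c).welfare s ≤ Fintype.card ι := by
    have hu : ∀ v, (ofWeightGraph G H c).utility s v
        ≤ if v ∈ Finset.univ.map f then 1 / 2 else 0 := by
      intro v
      rw [utility_ofWeightGraph hHG]
      split_ifs with hv
      · gcongr
        exact_mod_cast card_pairGraph_color_le_one col.injective a (s v) v
      · refine (div_eq_zero_iff.2 (Or.inl ?_)).le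
        rw [Nat.cast_eq_zero, Finset.card_eq_zero, Finset.filter_eq_empty_iff]
        rintro w - ⟨⟨-, p, q, rfl, -⟩, -⟩
        simp at hv
    refine (Finset.sum_le_sum fun v _ => hu v).trans ?_
    rw [← Finset.sum_filter]
    simp only [Finset.filter_mem_eq_inter, Finset.univ_inter, Finset.sum_const,
      Finset.card_map, Finset.card_univ, Fintype.card_prod, Fintype.card_bool, nsmul_eq_mul]
    push_cast
    linarith
  refine ClusteringGame.ofReal_le_poaClass (Γ := ofWeightGraph G H c) (s := s)
    (t := fun _ => a) ofWeightGraph_mem ?_ (fun _ => Set.mem_univ _) ?_ hr ?_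
  · exact isNash_ofWeightGraph hHG _ fun v b => card_pairGraph_color_le col.injective a b v
  · exact lt_of_lt_of_le (by exact_mod_cast Finset.card_pos.2 ⟨p₀, hp₀⟩) hopt
  · exact (mul_le_mul_of_nonneg_left heq hr).trans (h.trans hopt)

/-! ### Edge probabilities and the second moment -/

instance {V : Type*} [Countable V] : MeasurableSingletonClass (SimpleGraph V) where
  measurableSet_singleton G := by
    rw [← Set.preimage_image_eq {G} SimpleGraph.edgeSet_injective, Set.image_singleton]
    exact SimpleGraph.measurable_edgeSet (measurableSet_singleton _)

open MeasureTheory ProbabilityTheory in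
lemma SimpleGraph.binomialRandom_subset_edgeSet {V : Type*} [Finite V] (p : unitInterval)
    (T : Finset (Sym2 V)) (hT : ∀ e ∈ T, ¬ e.IsDiag) :
    G(V, p) {G | (T : Set (Sym2 V)) ⊆ G.edgeSet} = (unitInterval.toNNReal p : ℝ≥0∞) ^ T.card := by
  rw [binomialRandom_eq_map, Measure.map_apply measurable_fromEdgeSet (Set.toFinite _).measurableSet,
    setBernoulli_apply']
  have h : ((fun q : Sym2 V → Prop => {e | q e}) ⁻¹'
      (fromEdgeSet ⁻¹' {G | (T : Set (Sym2 V)) ⊆ G.edgeSet}))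
      = Set.pi (T : Set (Sym2 V)) fun _ => {True} := by
    ext q
    simp only [Set.mem_preimage, Set.mem_ofPred_eq, edgeSet_fromEdgeSet, Set.mem_pi,
      Set.mem_singleton_iff, eq_iff_iff, iff_true]
    exact ⟨fun h e he => (h he).1, fun h e he => ⟨h e he, hT e he⟩⟩
  rw [h, Measure.infinitePi_pi _ (fun _ _ => by measurability)]
  rw [Finset.prod_congr rfl (g := fun _ => (unitInterval.toNNReal p : ℝ≥0∞)), Finset.prod_const]
  intro e he
  have := hT e he
  simp [this]

open MeasureTheory ProbabilityTheory in
open Classical in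
/-- Second moment method for an array of events in which any two events in different rows and
columns are uncorrelated. -/
lemma measure_card_filter_lt_le {Ω : Type*} [MeasurableSpace Ω] [DiscreteMeasurableSpace Ω]
    (μ : Measure Ω) [IsProbabilityMeasure μ] {M : ℕ} (hM : 0 < M)
    (E : Fin M × Fin M → Set Ω) {q : ℝ} (hq : 0 < q) (hE : ∀ p, μ.real (E p) = q)
    (hEE : ∀ p p', p.1 ≠ p'.1 → p.2 ≠ p'.2 → μ.real (E p ∩ E p') = q ^ 2) :
    μ {ω | ((Finset.univ.filter fun p => ω ∈ E p).card : ℝ) < q * M ^ 2 / 2}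
      ≤ ENNReal.ofReal (8 / (q ^ 2 * M)) := by
  have hM' : (0 : ℝ) < M := by exact_mod_cast hM
  set X : Ω → ℝ := fun ω => ∑ p, (E p).indicator 1 ω with hX
  have hXcard : ∀ ω, X ω = (Finset.univ.filter fun p => ω ∈ E p).card := by
    intro ω
    simp [hX, Set.indicator_apply]
  have hint : ∀ A : Set Ω, Integrable (A.indicator (1 : Ω → ℝ)) μ := fun A =>
    (integrable_const (1 : ℝ)).indicator (.of_discrete)
  have hreal : ∀ A : Set Ω, ∫ ω, A.indicator (1 : Ω → ℝ) ω ∂μ = μ.real A := fun A =>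
    integral_indicator_one .of_discrete
  have hmean : μ[X] = q * M ^ 2 := by
    simp only [hX]
    rw [integral_finsetSum _ fun p _ => hint _]
    simp only [hreal, hE, Finset.sum_const, Finset.card_univ, Fintype.card_prod,
      Fintype.card_fin, nsmul_eq_mul, Nat.cast_mul]
    ring
  have hLp : MemLp X 2 μ := memLp_finsetSum _ fun p _ =>
    (memLp_const (1 : ℝ)).indicator (.of_discrete)
  have hsq : μ[X ^ 2] ≤ q ^ 2 * M ^ 4 + 2 * M ^ 3 := by
    have h1 : X ^ 2 = fun ω => ∑ p, ∑ p', (E p ∩ E p').indicator (1 : Ω → ℝ) ω := by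
      ext ω
      simp only [hX, Pi.pow_apply, sq, Finset.sum_mul_sum, Set.inter_indicator_one, Pi.mul_apply]
    -- Events sharing a row or a column are bounded trivially by 1; there are at most 2M³ such
    -- ordered combinations, against the M⁴ in the main term.
    have h2 : ∀ p p', μ.real (E p ∩ E p')
        ≤ q ^ 2 + ((if p.1 = p'.1 then 1 else 0) + if p.2 = p'.2 then 1 else 0) := by
      intro p p'
      have h3 : μ.real (E p ∩ E p') ≤ 1 := measureReal_le_one
      have h4 := sq_nonneg q
      by_cases h : p.1 = p'.1
      · rw [if_pos h]
        split_ifs <;> linarith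
      by_cases h' : p.2 = p'.2
      · rw [if_neg h, if_pos h']
        linarith
      rw [hEE p p' h h', if_neg h, if_neg h']
      simp
    rw [h1, integral_finsetSum _ fun p _ => integrable_finsetSum _ fun p' _ => hint _]
    calc ∑ p, ∫ ω, ∑ p', (E p ∩ E p').indicator (1 : Ω → ℝ) ω ∂μ
        = ∑ p, ∑ p', μ.real (E p ∩ E p') := by
          refine Finset.sum_congr rfl fun p _ => ?_
          rw [integral_finsetSum _ fun p' _ => hint _]
          simp only [hreal]
      _ ≤ ∑ p : Fin M × Fin M, ∑ p' : Fin M × Fin M,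
            (q ^ 2 + ((if p.1 = p'.1 then 1 else 0) + if p.2 = p'.2 then 1 else 0)) :=
          Finset.sum_le_sum fun p _ => Finset.sum_le_sum fun p' _ => h2 p p'
      _ = q ^ 2 * M ^ 4 + 2 * M ^ 3 := by
          have hrow : ∀ a : Fin M, (∑ x : Fin M, ∑ _y : Fin M, if a = x then (1 : ℝ) else 0)
              = M := by
            intro a
            rw [Finset.sum_comm]
            simp
          simp only [Finset.sum_add_distrib, Fintype.sum_prod_type, hrow, Finset.sum_const,
            Finset.card_univ, Fintype.card_prod, Nat.cast_mul, Fintype.card_fin, Finset.sum_ite_eq, Finset.mem_univ, if_true,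
            nsmul_eq_mul, mul_one]
          ring
  have hvar : variance X μ ≤ 2 * M ^ 3 := by
    rw [variance_eq_sub hLp, hmean]
    nlinarith
  have hpos : 0 < q * M ^ 2 / 2 := by positivity
  calc μ {ω | ((Finset.univ.filter fun p => ω ∈ E p).card : ℝ) < q * M ^ 2 / 2}
      ≤ μ {ω | q * M ^ 2 / 2 ≤ |X ω - μ[X]|} := by
        refine measure_mono fun ω hω => ?_
        simp only [Set.mem_ofPred_eq, ← hXcard] at hω
        rw [Set.mem_ofPred_eq, hmean, le_abs]
        right
        linarith
    _ ≤ ENNReal.ofReal (variance X μ / (q * M ^ 2 / 2) ^ 2) :=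
        meas_ge_le_variance_div_sq hLp hpos
    _ ≤ ENNReal.ofReal (8 / (q ^ 2 * M)) := by
        refine ENNReal.ofReal_le_ofReal ?_
        calc variance X μ / (q * M ^ 2 / 2) ^ 2 ≤ 2 * M ^ 3 / (q * M ^ 2 / 2) ^ 2 := by gcongr
          _ = 8 / (q ^ 2 * M) := by field_simp; norm_num

/-! ### Application to the random graph -/

/-- The edges of the pairs `i` and `j` and the edge between the first vertices of the pairs. -/
def pairEdges {V ι : Type*} [DecidableEq V] (f : ι × Bool ↪ V) (i j : ι) : Finset (Sym2 V) :=
  {s(f (i, false), f (i, true)), s(f (j, false), f (j, true)), s(f (i, false), f (j, false))}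

section pairEdges

variable {V ι : Type*} [DecidableEq V] {f : ι × Bool ↪ V} {i j i' j' : ι}

lemma card_pairEdges (hij : i ≠ j) : (pairEdges f i j).card = 3 := by
  rw [pairEdges, Finset.card_eq_three]
  exact ⟨_, _, _, by simp [hij], by simp, by simp, rfl⟩

lemma not_isDiag_of_mem_pairEdges (hij : i ≠ j) {e : Sym2 V} (he : e ∈ pairEdges f i j) :
    ¬ e.IsDiag := by
  simp only [pairEdges, Finset.mem_insert, Finset.mem_singleton] at he
  rcases he with rfl | rfl | rfl <;> simp [hij]

lemma disjoint_pairEdges (h₁ : i ≠ i') (h₂ : i ≠ j') (h₃ : j ≠ i') (h₄ : j ≠ j') :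
    Disjoint (pairEdges f i j) (pairEdges f i' j') := by
  simp [pairEdges, h₁.symm, h₂.symm, h₃.symm, h₄.symm]

lemma coe_pairEdges_subset_edgeSet {G : SimpleGraph V} :
    (pairEdges f i j : Set (Sym2 V)) ⊆ G.edgeSet ↔ G.Adj (f (i, false)) (f (i, true)) ∧
      G.Adj (f (j, false)) (f (j, true)) ∧ G.Adj (f (i, false)) (f (j, false)) := by
  simp [pairEdges, Set.insert_subset_iff]

end pairEdges

open ClusteringGame in
open Classical in
-- At least p³M²/2 good combinations against 2M pairs give the ratio p³M/4. Splitting the pairs into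
-- two halves makes events in different rows and columns depend on disjoint edge sets, and orients
-- every combination.
lemma one_sub_le_binomialRandom_poaClass {n c M : ℕ} (p : unitInterval) (hp : 0 < (p : ℝ))
    (hM : 0 < M) (hn : 4 * M ≤ n) (hc : 2 * M ≤ c) :
    1 - ENNReal.ofReal (8 / (((p : ℝ) ^ 3) ^ 2 * M)) ≤
      G(Fin n, p) {G | ENNReal.ofReal ((p : ℝ) ^ 3 * M / 4) ≤
        poaClass (symmetricCoordinationGames G c)} := by
  have hM' : (0 : ℝ) < M := by exact_mod_cast hM
  obtain ⟨f⟩ : Nonempty ((Fin M ⊕ Fin M) × Bool ↪ Fin n) :=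
    Function.Embedding.nonempty_of_card_le (by simp; omega)
  obtain ⟨col⟩ : Nonempty (Fin M ⊕ Fin M ↪ Fin c) :=
    Function.Embedding.nonempty_of_card_le (by simp; omega)
  set E : Fin M × Fin M → Set (SimpleGraph (Fin n)) := fun q =>
    {G | (pairEdges f (.inl q.1) (.inr q.2) : Set (Sym2 (Fin n))) ⊆ G.edgeSet} with hE
  have hprob : ∀ q, G(Fin n, p).real (E q) = (p : ℝ) ^ 3 := by
    intro q
    rw [MeasureTheory.measureReal_def, hE, SimpleGraph.binomialRandom_subset_edgeSet _ _
      fun e he => not_isDiag_of_mem_pairEdges (by simp) he, card_pairEdges (by simp)]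
    simp
  have hprob₂ : ∀ q q', q.1 ≠ q'.1 → q.2 ≠ q'.2 →
      G(Fin n, p).real (E q ∩ E q') = ((p : ℝ) ^ 3) ^ 2 := by
    intro q q' h₁ h₂
    have hinter : E q ∩ E q' = {G | ((pairEdges f (.inl q.1) (.inr q.2) ∪
        pairEdges f (.inl q'.1) (.inr q'.2) : Finset (Sym2 (Fin n))) : Set (Sym2 (Fin n)))
          ⊆ G.edgeSet} := by
      ext G
      simp [hE]
    rw [hinter, MeasureTheory.measureReal_def, SimpleGraph.binomialRandom_subset_edgeSet,
      Finset.card_union_of_disjoint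
        (disjoint_pairEdges (by simpa using h₁) (by simp) (by simp) (by simpa using h₂)),
      card_pairEdges (by simp), card_pairEdges (by simp)]
    · simp
      ring
    · intro e he
      rcases Finset.mem_union.1 he with he | he <;>
        exact not_isDiag_of_mem_pairEdges (by simp) he
  have hcheb := measure_card_filter_lt_le G(Fin n, p) hM E (pow_pos hp 3) hprob hprob₂
  refine le_trans (tsub_le_tsub_left hcheb 1) ?_
  rw [← MeasureTheory.prob_compl_eq_one_sub (Set.toFinite _).measurableSet]
  refine MeasureTheory.measure_mono fun G hG => ?_
  simp only [Set.mem_compl_iff, Set.mem_ofPred_eq, not_lt] at hG ⊢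
  have hcard : 0 < (p : ℝ) ^ 3 * M ^ 2 / 2 := by positivity
  refine ofReal_le_poaClass_of_pairs G f col
    ((Finset.univ.filter fun q => G ∈ E q).image fun q => (Sum.inl q.1, Sum.inr q.2))
    ?_ ?_ ?_ (by positivity) ?_
  · rw [Finset.image_nonempty, ← Finset.card_pos]
    exact_mod_cast hcard.trans_le hG
  · simp only [Finset.mem_image]
    rintro - ⟨q, -, rfl⟩ - ⟨q', -, rfl⟩
    simp
  · intro r hr
    obtain ⟨q, hq, rfl⟩ := Finset.mem_image.1 hr
    exact coe_pairEdges_subset_edgeSet.1 (Finset.mem_filter.1 hq).2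
  · rw [Finset.card_image_of_injective _ fun q q' h => by
      simpa [Prod.ext_iff] using h]
    refine le_trans (le_of_eq ?_) hG
    simp
    ring

theorem theorem5 (d : ℝ) (hd : d ∈ Set.Ioc (0 : ℝ) 1) :
    ∃ β : ℝ, 0 < β ∧
      ∀ c : ℕ → ℕ, Tendsto c atTop atTop →
        Tendsto
          (fun n : ℕ =>
            G(Fin n, (⟨d, hd.1.le, hd.2⟩ : unitInterval))
              {G : SimpleGraph (Fin n) |
                ENNReal.ofReal (β * min (c n : ℝ) (n : ℝ)) ≤
                  ClusteringGame.poaClass (symmetricCoordinationGames G (c n))})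
          atTop (𝓝 1) := by
  have hd0 : 0 < d := hd.1
  -- The ratio is d³M/4 with M = ⌊min(c, n)/4⌋, and M ≥ min(c, n)/8 once M ≥ 1.
  refine ⟨d ^ 3 / 32, by positivity, fun c hc => ?_⟩
  have hM : Tendsto (fun n => min (c n) n / 4) atTop atTop :=
    (Nat.tendsto_div_const_atTop four_ne_zero).comp (tendsto_inf_atTop _ hc tendsto_id)
  have hlim : Tendsto (fun n => 1 - ENNReal.ofReal
      (8 / ((d ^ 3) ^ 2 * ((min (c n) n / 4 : ℕ) : ℝ)))) atTop (𝓝 1) := by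
    have h0 : Tendsto (fun n => 8 / ((d ^ 3) ^ 2 * ((min (c n) n / 4 : ℕ) : ℝ))) atTop (𝓝 0) :=
      ((tendsto_natCast_atTop_atTop.comp hM).const_mul_atTop (by positivity)).const_div_atTop 8
    simpa using ENNReal.Tendsto.sub tendsto_const_nhds (ENNReal.tendsto_ofReal h0)
      (Or.inl ENNReal.one_ne_top)
  refine tendsto_of_tendsto_of_tendsto_of_le_of_le' hlim tendsto_const_nhds ?_
    (Eventually.of_forall fun n => MeasureTheory.prob_le_one)
  filter_upwards [hM.eventually_gt_atTop 0] with n hn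
  refine (one_sub_le_binomialRandom_poaClass (n := n) (c := c n) ⟨d, hd.1.le, hd.2⟩ hd0 hn
    (by omega) (by omega)).trans (MeasureTheory.measure_mono fun G hG => ?_)
  refine le_trans (ENNReal.ofReal_le_ofReal ?_) hG
  have hmin : (min (c n : ℝ) n) ≤ 8 * ((min (c n) n / 4 : ℕ) : ℝ) := by
    rw [← Nat.cast_min]
    exact_mod_cast (by omega : min (c n) n ≤ 8 * (min (c n) n / 4))
  calc d ^ 3 / 32 * min (c n : ℝ) n ≤ d ^ 3 / 32 * (8 * ((min (c n) n / 4 : ℕ) : ℝ)) := by gcongr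
    _ = d ^ 3 * ((min (c n) n / 4 : ℕ) : ℝ) / 4 := by ring
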